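/- Let $p\ge 1$ and $\alpha,\beta>-1$ be real numbers and let $d\mu^{\alpha,\beta}(x)=(1-x)^{\alpha}(1+x)^{\beta}\,dx$ on $(-1,1)$. For an integer $\ell\ge 1$ and $\varpi=(\omega_0,\dots,\omega_{\ell-1})\in\mathbb{R}^{\ell}$ put $$\|f\|=\Big(\sum_{k=0}^{\ell-1}|f^{(k)}(\omega_k)|^p+\int_{-1}^{1}|f^{(\ell)}(x)|^p\,d\mu^{\alpha,\beta}(x)\Big)^{1/p}.$$ Let $W_{\varpi}$ be the completion of the space of real polynomials with respect to $\|\cdot\|$. Let $U_{\varpi}$ be the normed space of classes, under the relation $f\sim g\iff\|f-g\|=0$, of functions $f:\mathbb{R}\to\mathbb{R}$ such that (1) for $k=1,\dots,\ell-1$, $f$ has a derivative of order $k$ at $\omega_k$; (2) $f$ is $\ell-1$ times differentiable on $(-1,1)$ and $f^{(\ell-1)}$ is absolutely continuous on every compact subinterval of $(-1,1)$; (3) $f^{(\ell)}\in L^p(\mu^{\alpha,\beta})$. Write $W_{\varpi}=U_{\varpi}$ if there is a linear isometry of $U_{\varpi}$ onto $W_{\varpi}$ that sends the class of each polynomial to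 that polynomial. Then: 1. If $\ell=1$, then $W_{\omega_0}=U_{\omega_0}$ for every $\omega_0\in\mathbb{R}$. 2. If $\ell\ge 2$ and $p>1$, then $W_{\varpi}=U_{\varpi}$ for all $\varpi\in\mathbb{R}^{\ell}$ if and only if $\alpha,\beta\in(-1,p-1)$. 3. If $\ell\ge 2$ and $p=1$, then $W_{\varpi}=U_{\varpi}$ for all $\varpi\in\mathbb{R}^{\ell}$ if and only if $\alpha,\beta\in(-1,0]$. -/

import Mathlib

open MeasureTheory Set Filter Topology Polynomial

namespace JacobiSobolev

noncomputable section

/-- The Jacobi measure `(1-x)^α (1+x)^β dx` on `(-1,1)` (the endpoints are Lebesgue-null). -/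
def jacobiMeasure (α β : ℝ) : Measure ℝ :=
  (volume.restrict (Ioo (-1 : ℝ) 1)).withDensity
    fun x => ENNReal.ofReal ((1 - x) ^ α * (1 + x) ^ β)

/-- `DiffAtOrder k f x`: the function `f` has a derivative of order `k` at `x`, i.e. it is `k-1`
times differentiable in a neighbourhood of `x` and its derivative of order `k-1` is
differentiable at `x`. -/
def DiffAtOrder : ℕ → (ℝ → ℝ) → ℝ → Prop
  | 0, _, _ => True
  | k + 1, f, x =>
      (∀ᶠ y in 𝓝 x, DiffAtOrder k f y) ∧ DifferentiableAt ℝ (iteratedDeriv k f) x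

/-- The norm `(∑_{k<ℓ} |f^{(k)}(ω_k)|^p + ∫_{-1}^1 |f^{(ℓ)}|^p dμ^{α,β})^{1/p}`. -/
def jsNorm (p α β : ℝ) (ℓ : ℕ) (ω : Fin ℓ → ℝ) (f : ℝ → ℝ) : ℝ :=
  ((∑ k : Fin ℓ, |iteratedDeriv k f (ω k)| ^ p) +
    ∫ x, |iteratedDeriv ℓ f x| ^ p ∂(jacobiMeasure α β)) ^ (1 / p)

/-- The conditions that define the function space: existence of the `k`-th derivative at `ω_k`,
`ℓ-1` times differentiability on `(-1,1)` with `f^{(ℓ-1)}` absolutely continuous on the compact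
subintervals of `(-1,1)`, and `f^{(ℓ)} ∈ L^p(μ^{α,β})`. -/
structure IsSuitable (p α β : ℝ) (ℓ : ℕ) (ω : Fin ℓ → ℝ) (f : ℝ → ℝ) : Prop where
  diffAt_node : ∀ k : Fin ℓ, DiffAtOrder k f (ω k)
  diffAt_interior : ∀ x ∈ Ioo (-1 : ℝ) 1, DiffAtOrder (ℓ - 1) f x
  absCont : ∀ a b : ℝ, -1 < a → a ≤ b → b < 1 →
    AbsolutelyContinuousOnInterval (iteratedDeriv (ℓ - 1) f) a b
  memLp : MemLp (iteratedDeriv ℓ f) (ENNReal.ofReal p) (jacobiMeasure α β)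

theorem DiffAtOrder.add {k : ℕ} {f g : ℝ → ℝ} {x : ℝ} (hf : DiffAtOrder k f x)
    (hg : DiffAtOrder k g x) : DiffAtOrder k (f + g) x ∧
      iteratedDeriv k (f + g) x = iteratedDeriv k f x + iteratedDeriv k g x := by
  induction k generalizing x with
  | zero => exact ⟨trivial, by simp⟩
  | succ k ih =>
    have h := hf.1.and hg.1
    have heq : iteratedDeriv k (f + g) =ᶠ[𝓝 x] iteratedDeriv k f + iteratedDeriv k g := by
      filter_upwards [h] with y hy
      exact (ih hy.1 hy.2).2
    refine ⟨⟨?_, ?_⟩, ?_⟩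
    · filter_upwards [h] with y hy
      exact (ih hy.1 hy.2).1
    · exact (hf.2.add hg.2).congr_of_eventuallyEq heq
    · rw [iteratedDeriv_succ, iteratedDeriv_succ, iteratedDeriv_succ, heq.deriv_eq,
        deriv_add hf.2 hg.2]

theorem iteratedDeriv_smul' (k : ℕ) (c : ℝ) (f : ℝ → ℝ) :
    iteratedDeriv k (c • f) = c • iteratedDeriv k f := by
  funext x
  simp

theorem DiffAtOrder.smul {k : ℕ} {f : ℝ → ℝ} {x : ℝ} (c : ℝ) (hf : DiffAtOrder k f x) :
    DiffAtOrder k (c • f) x := by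
  induction k generalizing x with
  | zero => trivial
  | succ k ih =>
    refine ⟨hf.1.mono fun y hy => ih hy, ?_⟩
    rw [iteratedDeriv_smul']
    exact hf.2.const_smul c

theorem jacobiMeasure_ac (α β : ℝ) :
    jacobiMeasure α β ≪ volume.restrict (Ioo (-1 : ℝ) 1) :=
  withDensity_absolutelyContinuous _ _

namespace IsSuitable

variable {p α β : ℝ} {ℓ : ℕ} {ω : Fin ℓ → ℝ} {f g : ℝ → ℝ}

theorem ae_differentiableAt (hf : IsSuitable p α β ℓ ω f) :
    ∀ᵐ x ∂(volume.restrict (Ioo (-1 : ℝ) 1)),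
      DifferentiableAt ℝ (iteratedDeriv (ℓ - 1) f) x := by
  rw [ae_restrict_iff' measurableSet_Ioo]
  have h : ∀ n : ℕ, ∀ᵐ x : ℝ, x ∈ uIcc (-1 + 1 / ((n : ℝ) + 1)) (1 - 1 / ((n : ℝ) + 1)) →
      x ∈ Icc (-1 + 1 / ((n : ℝ) + 1)) (1 - 1 / ((n : ℝ) + 1)) →
      DifferentiableAt ℝ (iteratedDeriv (ℓ - 1) f) x := by
    intro n
    have hn : 0 < 1 / ((n : ℝ) + 1) := by positivity
    by_cases hle : -1 + 1 / ((n : ℝ) + 1) ≤ 1 - 1 / ((n : ℝ) + 1)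
    · filter_upwards [(hf.absCont _ _ (by linarith) hle (by linarith)).ae_differentiableAt]
        with x hx h1 _
      exact hx h1
    · filter_upwards with x _ h2
      exact absurd (h2.1.trans h2.2) hle
  filter_upwards [ae_all_iff.2 h] with x hx hx1
  obtain ⟨n, hn⟩ := exists_nat_one_div_lt (lt_min (show 0 < x + 1 by linarith [hx1.1])
    (show 0 < 1 - x by linarith [hx1.2]))
  have h1 := hn.trans_le (min_le_left _ _)
  have h2 := hn.trans_le (min_le_right _ _)
  have h3 : x ∈ Icc (-1 + 1 / ((n : ℝ) + 1)) (1 - 1 / ((n : ℝ) + 1)) :=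
    ⟨by linarith, by linarith⟩
  exact hx n (Icc_subset_uIcc h3) h3

theorem ae_iteratedDeriv_add (hf : IsSuitable p α β ℓ ω f) (hg : IsSuitable p α β ℓ ω g) :
    iteratedDeriv ℓ (f + g) =ᵐ[jacobiMeasure α β] iteratedDeriv ℓ f + iteratedDeriv ℓ g := by
  apply (jacobiMeasure_ac α β).ae_eq
  filter_upwards [hf.ae_differentiableAt, hg.ae_differentiableAt,
    ae_restrict_mem measurableSet_Ioo] with x h1 h2 hx
  cases ℓ with
  | zero => simp
  | succ n =>
    have hev : ∀ᶠ y in 𝓝 x, y ∈ Ioo (-1 : ℝ) 1 := isOpen_Ioo.mem_nhds hx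
    exact (DiffAtOrder.add (k := n + 1) (x := x)
      ⟨hev.mono fun y hy => hf.diffAt_interior y hy, h1⟩
      ⟨hev.mono fun y hy => hg.diffAt_interior y hy, h2⟩).2

theorem add (hf : IsSuitable p α β ℓ ω f) (hg : IsSuitable p α β ℓ ω g) :
    IsSuitable p α β ℓ ω (f + g) where
  diffAt_node k := ((hf.diffAt_node k).add (hg.diffAt_node k)).1
  diffAt_interior x hx := ((hf.diffAt_interior x hx).add (hg.diffAt_interior x hx)).1
  absCont a b ha hab hb := by
    refine ((hf.absCont a b ha hab hb).add (hg.absCont a b ha hab hb)).congr' ?_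
    refine Filter.eventuallyEq_of_mem (mem_inf_of_right (mem_principal_self _)) ?_
    rintro ⟨n, I⟩ hI
    refine Finset.sum_congr rfl fun i hi => ?_
    have hsub : ∀ y ∈ uIcc a b, iteratedDeriv (ℓ - 1) (f + g) y =
        iteratedDeriv (ℓ - 1) f y + iteratedDeriv (ℓ - 1) g y := by
      intro y hy
      rw [uIcc_of_le hab] at hy
      have hy' : y ∈ Ioo (-1 : ℝ) 1 := ⟨by linarith [hy.1], by linarith [hy.2]⟩
      exact ((hf.diffAt_interior y hy').add (hg.diffAt_interior y hy')).2
    have := hI.1 i hi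
    simp only [Pi.add_apply]
    rw [hsub _ this.1, hsub _ this.2]
  memLp := (hf.memLp.add hg.memLp).ae_eq (hf.ae_iteratedDeriv_add hg).symm

theorem smul (c : ℝ) (hf : IsSuitable p α β ℓ ω f) : IsSuitable p α β ℓ ω (c • f) where
  diffAt_node k := (hf.diffAt_node k).smul c
  diffAt_interior x hx := (hf.diffAt_interior x hx).smul c
  absCont a b ha hab hb := by
    rw [iteratedDeriv_smul']
    exact (hf.absCont a b ha hab hb).const_mul c
  memLp := by
    rw [iteratedDeriv_smul']
    exact hf.memLp.const_smul c

theorem integral_eq (hp : 1 ≤ p) (hf : IsSuitable p α β ℓ ω f) :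
    ∫ x, |iteratedDeriv ℓ f x| ^ p ∂(jacobiMeasure α β) =
      |lpNorm (iteratedDeriv ℓ f) (ENNReal.ofReal p) (jacobiMeasure α β)| ^ p := by
  have hp0 : 0 < p := by linarith
  rw [abs_of_nonneg lpNorm_nonneg, lpNorm_eq_integral_norm_rpow_toReal (by simpa using hp0)
    ENNReal.ofReal_ne_top hf.memLp.1, ENNReal.toReal_ofReal hp0.le,
    Real.rpow_inv_rpow _ hp0.ne']
  · rfl
  · exact integral_nonneg fun x => by positivity

theorem jsNorm_eq (hp : 1 ≤ p) (hf : IsSuitable p α β ℓ ω f) :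
    jsNorm p α β ℓ ω f = (∑ i : Option (Fin ℓ), |i.elim
      (lpNorm (iteratedDeriv ℓ f) (ENNReal.ofReal p) (jacobiMeasure α β))
      (fun k => iteratedDeriv k f (ω k))| ^ p) ^ (1 / p) := by
  rw [jsNorm, hf.integral_eq hp, Fintype.sum_option, add_comm]
  rfl

theorem jsNorm_add_le (hp : 1 ≤ p) (hf : IsSuitable p α β ℓ ω f)
    (hg : IsSuitable p α β ℓ ω g) :
    jsNorm p α β ℓ ω (f + g) ≤ jsNorm p α β ℓ ω f + jsNorm p α β ℓ ω g := by
  rw [(hf.add hg).jsNorm_eq hp, hf.jsNorm_eq hp, hg.jsNorm_eq hp]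
  refine le_trans ?_ (Real.Lp_add_le _ _ _ hp)
  refine Real.rpow_le_rpow (by positivity) (Finset.sum_le_sum fun i _ => ?_)
    (by have : 0 < p := by linarith
        positivity)
  cases i with
  | none =>
    refine Real.rpow_le_rpow (abs_nonneg _) (abs_le_abs_of_nonneg lpNorm_nonneg ?_)
      (by linarith)
    have hp1 : 1 ≤ ENNReal.ofReal p := by simpa using hp
    have h : lpNorm (iteratedDeriv ℓ (f + g)) (ENNReal.ofReal p) (jacobiMeasure α β) =
        lpNorm (iteratedDeriv ℓ f + iteratedDeriv ℓ g) (ENNReal.ofReal p)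
          (jacobiMeasure α β) := by
      rw [← toReal_eLpNorm (hf.add hg).memLp.1, ← toReal_eLpNorm (hf.memLp.add hg.memLp).1,
        eLpNorm_congr_ae (hf.ae_iteratedDeriv_add hg)]
    exact h.trans_le (lpNorm_add_le hf.memLp hp1)
  | some k =>
    simp only [Option.elim]
    rw [((hf.diffAt_node k).add (hg.diffAt_node k)).2]

end IsSuitable

theorem jsNorm_smul {p : ℝ} (hp : 1 ≤ p) (α β : ℝ) {ℓ : ℕ} (ω : Fin ℓ → ℝ) (c : ℝ)
    (f : ℝ → ℝ) : jsNorm p α β ℓ ω (c • f) = ‖c‖ * jsNorm p α β ℓ ω f := by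
  have hp0 : 0 < p := by linarith
  simp only [jsNorm, iteratedDeriv_smul', Pi.smul_apply, smul_eq_mul, abs_mul,
    Real.mul_rpow (abs_nonneg _) (abs_nonneg _), ← Finset.mul_sum, integral_const_mul,
    ← mul_add]
  rw [Real.mul_rpow (by positivity)
    (add_nonneg (by positivity) (integral_nonneg fun x => by positivity)),
    one_div, Real.rpow_rpow_inv (abs_nonneg _) hp0.ne', Real.norm_eq_abs]

theorem jsNorm_nonneg (p α β : ℝ) {ℓ : ℕ} (ω : Fin ℓ → ℝ) (f : ℝ → ℝ) :
    0 ≤ jsNorm p α β ℓ ω f :=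
  Real.rpow_nonneg (add_nonneg (Finset.sum_nonneg fun _ _ => by positivity)
    (integral_nonneg fun x => by positivity)) _

/-! ### Polynomials are suitable -/

theorem iteratedDeriv_eval (k : ℕ) (P : ℝ[X]) :
    iteratedDeriv k (fun x => P.eval x) = fun x => (derivative^[k] P).eval x := by
  induction k with
  | zero => simp
  | succ k ih =>
    rw [iteratedDeriv_succ, ih, Function.iterate_succ_apply']
    funext x
    simp

theorem diffAtOrder_eval (k : ℕ) (P : ℝ[X]) (x : ℝ) :
    DiffAtOrder k (fun x => P.eval x) x := by
  induction k generalizing x with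
  | zero => trivial
  | succ k ih =>
    refine ⟨Eventually.of_forall ih, ?_⟩
    rw [iteratedDeriv_eval]
    exact Polynomial.differentiableAt _

theorem isFiniteMeasure_jacobiMeasure {α β : ℝ} (hα : -1 < α) (hβ : -1 < β) :
    IsFiniteMeasure (jacobiMeasure α β) := by
  have h1 : IntervalIntegrable (fun x : ℝ => (1 - x) ^ α * (1 + x) ^ β) volume (-1) 0 := by
    have h : IntervalIntegrable (fun x : ℝ => (1 + x) ^ β) volume (-1) 0 := by
      simpa using (intervalIntegral.intervalIntegrable_rpow' (a := 0) (b := 1) hβ).comp_add_left 1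
    refine h.continuousOn_mul ?_
    refine ContinuousOn.rpow_const (by fun_prop) fun x hx => Or.inl ?_
    rw [uIcc_of_le (by norm_num)] at hx
    linarith [hx.2]
  have h2 : IntervalIntegrable (fun x : ℝ => (1 - x) ^ α * (1 + x) ^ β) volume 0 1 := by
    have h : IntervalIntegrable (fun x : ℝ => (1 - x) ^ α) volume 0 1 := by
      simpa using
        (intervalIntegral.intervalIntegrable_rpow' (a := 1) (b := 0) hα).comp_sub_left 1
    refine h.mul_continuousOn ?_
    refine ContinuousOn.rpow_const (by fun_prop) fun x hx => Or.inl ?_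
    rw [uIcc_of_le (by norm_num)] at hx
    linarith [hx.1]
  have h3 := h1.trans h2
  rw [intervalIntegrable_iff_integrableOn_Ioo_of_le (by norm_num)] at h3
  exact isFiniteMeasure_withDensity_ofReal h3.2

theorem isSuitable_eval {p α β : ℝ} (hα : -1 < α) (hβ : -1 < β) {ℓ : ℕ}
    (ω : Fin ℓ → ℝ) (P : ℝ[X]) : IsSuitable p α β ℓ ω (fun x => P.eval x) where
  diffAt_node k := diffAtOrder_eval k P _
  diffAt_interior x _ := diffAtOrder_eval _ P x
  absCont a b _ _ _ := by
    rw [iteratedDeriv_eval]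
    have h : ContDiff ℝ 1 fun x => Polynomial.eval x (derivative^[ℓ - 1] P) := by
      simpa using Polynomial.contDiff_aeval (𝕜 := ℝ) (derivative^[ℓ - 1] P) 1
    exact h.contDiffOn.absolutelyContinuousOnInterval
  memLp := by
    have := isFiniteMeasure_jacobiMeasure hα hβ
    rw [iteratedDeriv_eval]
    obtain ⟨C, hC⟩ := (isCompact_Icc (a := (-1 : ℝ)) (b := 1)).exists_bound_of_continuousOn
      (Polynomial.continuous (derivative^[ℓ] P)).continuousOn
    refine MemLp.of_bound (Polynomial.continuous _).aestronglyMeasurable C ?_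
    refine (jacobiMeasure_ac α β).ae_le ?_
    filter_upwards [ae_restrict_mem measurableSet_Ioo] with x hx
    exact hC x (Ioo_subset_Icc_self hx)

/-! ### The seminormed space of suitable functions and the space `U` -/

/-- The suitable functions, as a linear subspace of the space of all functions `ℝ → ℝ`. -/
def suitableSubmodule (p α β : ℝ) (ℓ : ℕ) (ω : Fin ℓ → ℝ) :
    Submodule ℝ (ℝ → ℝ) where
  carrier := {f | IsSuitable p α β ℓ ω f}
  add_mem' hf hg := hf.add hg
  zero_mem' := by
    have h0 : (0 : ℝ → ℝ) = fun x => (0 : ℝ[X]).eval x := by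
      funext x
      simp
    refine ⟨fun k => ?_, fun x _ => ?_, fun a b _ _ _ => ?_, ?_⟩
    · rw [h0]
      exact diffAtOrder_eval k (0 : ℝ[X]) (ω k)
    · rw [h0]
      exact diffAtOrder_eval (ℓ - 1) (0 : ℝ[X]) x
    · have h : iteratedDeriv (ℓ - 1) (0 : ℝ → ℝ) = fun _ => 0 := by
        funext x; exact iteratedDeriv_const_zero
      rw [h]
      exact contDiff_const.contDiffOn.absolutelyContinuousOnInterval
    · have h : iteratedDeriv ℓ (0 : ℝ → ℝ) = fun _ => 0 := by
        funext x; exact iteratedDeriv_const_zero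
      rw [h]
      exact MemLp.zero'
  smul_mem' c _ hf := hf.smul c

/-- The linear space of suitable functions, seminormed by `jsNorm`. (A type of its own, so that
it does not carry the topology of pointwise convergence.) -/
def SuitableFun (p α β : ℝ) (ℓ : ℕ) (ω : Fin ℓ → ℝ) : Type :=
  ↥(suitableSubmodule p α β ℓ ω)

/-- The linear space of real polynomials, to be normed by `jsNorm`. -/
def PolySpace (_p _α _β : ℝ) (ℓ : ℕ) (_ω : Fin ℓ → ℝ) : Type := ℝ[X]

section Spaces

variable (p α β : ℝ) (ℓ : ℕ) (ω : Fin ℓ → ℝ)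

instance : AddCommGroup (SuitableFun p α β ℓ ω) :=
  inferInstanceAs (AddCommGroup ↥(suitableSubmodule p α β ℓ ω))

instance : Module ℝ (SuitableFun p α β ℓ ω) :=
  inferInstanceAs (Module ℝ ↥(suitableSubmodule p α β ℓ ω))

instance : Norm (SuitableFun p α β ℓ ω) := ⟨fun f => jsNorm p α β ℓ ω f.1⟩

instance : AddCommGroup (PolySpace p α β ℓ ω) := inferInstanceAs (AddCommGroup ℝ[X])

instance : Module ℝ (PolySpace p α β ℓ ω) := inferInstanceAs (Module ℝ ℝ[X])

instance : Norm (PolySpace p α β ℓ ω) :=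
  ⟨fun P => jsNorm p α β ℓ ω fun x => Polynomial.eval x (show ℝ[X] from P)⟩

variable [hp : Fact (1 ≤ p)]

theorem suitableFun_core : SeminormedSpace.Core ℝ (SuitableFun p α β ℓ ω) where
  norm_nonneg f := jsNorm_nonneg p α β ω f.1
  norm_smul c f := jsNorm_smul hp.out α β ω c f.1
  norm_triangle f g := f.2.jsNorm_add_le hp.out g.2

instance : SeminormedAddCommGroup (SuitableFun p α β ℓ ω) :=
  SeminormedAddCommGroup.ofCore (suitableFun_core p α β ℓ ω)

instance : NormedSpace ℝ (SuitableFun p α β ℓ ω) where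
  norm_smul_le c f := (jsNorm_smul hp.out α β ω c f.1).le

/-- The space `U`: suitable functions modulo `f ∼ g` iff `‖f - g‖ = 0`, with the quotient norm
`‖[f]‖ = ‖f‖`. -/
abbrev U : Type := SeparationQuotient (SuitableFun p α β ℓ ω)

variable [hα : Fact (-1 < α)] [hβ : Fact (-1 < β)]

/-- A polynomial, as a suitable function. -/
def polyToFun (P : PolySpace p α β ℓ ω) : SuitableFun p α β ℓ ω :=
  ⟨fun x => Polynomial.eval x (show ℝ[X] from P), isSuitable_eval hα.out hβ.out ω P⟩

theorem polySpace_core : SeminormedSpace.Core ℝ (PolySpace p α β ℓ ω) where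
  norm_nonneg P := jsNorm_nonneg p α β ω _
  norm_smul c P := by
    have h : polyToFun p α β ℓ ω (c • P) = c • polyToFun p α β ℓ ω P :=
      Subtype.ext (funext fun x => Polynomial.eval_smul (x := x) c (show ℝ[X] from P))
    exact (congrArg norm h).trans (jsNorm_smul hp.out α β ω c _)
  norm_triangle P Q := by
    have h : polyToFun p α β ℓ ω (P + Q) = polyToFun p α β ℓ ω P + polyToFun p α β ℓ ω Q :=
      Subtype.ext (funext fun x =>
        Polynomial.eval_add (x := x) (p := (show ℝ[X] from P)) (q := (show ℝ[X] from Q)))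
    exact (congrArg norm h).trans_le
      ((suitableFun_core p α β ℓ ω).norm_triangle _ _)

instance : SeminormedAddCommGroup (PolySpace p α β ℓ ω) :=
  SeminormedAddCommGroup.ofCore (polySpace_core p α β ℓ ω)

instance : NormedSpace ℝ (PolySpace p α β ℓ ω) where
  norm_smul_le c P := ((polySpace_core p α β ℓ ω).norm_smul c P).le

/-- The space `W`: the completion of the polynomials with respect to `jsNorm`, i.e. the classes of
Cauchy sequences of polynomials modulo sequences whose difference has norm tending to `0`. -/
abbrev W : Type := UniformSpace.Completion (PolySpace p α β ℓ ω)

/-- `W = U`: there is a linear isometry of `U` onto `W` which carries the class of every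
polynomial in `U` to the same polynomial in `W`. (Such an isometry necessarily sends the class of
`f` to the class of any sequence of polynomials that converges to `f` in norm.) -/
def WEqU : Prop :=
  ∃ e : U p α β ℓ ω ≃ₗᵢ[ℝ] W p α β ℓ ω,
    ∀ P : PolySpace p α β ℓ ω,
      e (SeparationQuotient.mk (polyToFun p α β ℓ ω P)) = (P : W p α β ℓ ω)

end Spaces

end

end JacobiSobolev

/-! Sending a suitable function to its nodal values `f^{(k)}(ω_k)` and to its top derivative
`f^{(ℓ)}` is an isometry into the Banach space `ℝ^ℓ ⊕ L^p(μ^{α,β})`, and the image of the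
polynomials is dense. Hence `W = U` if and only if this isometry is onto, that is, if and only if
every `g ∈ L^p(μ^{α,β})` is the `ℓ`-th derivative of a suitable function.

For `ℓ = 1` the primitive `∫_0^x g` always works. For `ℓ ≥ 2` an iterated primitive works at all
nodes as soon as `L^p(μ^{α,β}) ⊆ L^1(-1,1)`. Conversely, put all nodes at an endpoint and solve
`f^{(ℓ)} = |g|`: then `f^{(ℓ-2)}` is convex on `(-1,1)` and differentiable at the endpoint, so
`f^{(ℓ-1)}` is monotone up to the endpoint, which forces `g` to be integrable there.

The inclusion `L^p(μ^{α,β}) ⊆ L^1(-1,1)` follows from Hölder's inequality in the stated range of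
parameters. It fails outside that range because of `(1-x)⁻¹ (1 - log (1-x))⁻¹` for `p > 1` and of
`(1-x)⁻¹` for `p = 1`. -/

namespace JacobiSobolev

noncomputable section

/-! ### Polynomials with prescribed data, and their density in `L^p` -/

theorem derivative_surjective {K : Type*} [Field K] [CharZero K] :
    Function.Surjective (derivative : K[X] → K[X]) := by
  intro Q
  induction Q using Polynomial.induction_on' with
  | add P Q hP hQ =>
    obtain ⟨P', rfl⟩ := hP
    obtain ⟨Q', rfl⟩ := hQ
    exact ⟨P' + Q', derivative_add⟩
  | monomial n a =>
    refine ⟨monomial (n + 1) (a / (n + 1)), ?_⟩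
    rw [derivative_monomial, Nat.add_sub_cancel, Nat.cast_add_one,
      div_mul_cancel₀ _ n.cast_add_one_ne_zero]

theorem exists_iterate_derivative_eq_and_eval_eq {K : Type*} [Field K] [CharZero K] (ℓ : ℕ)
    (ω c : Fin ℓ → K) (Q : K[X]) :
    ∃ P : K[X], derivative^[ℓ] P = Q ∧ ∀ k : Fin ℓ, (derivative^[k] P).eval (ω k) = c k := by
  induction ℓ generalizing Q with
  | zero => exact ⟨Q, rfl, fun k => k.elim0⟩
  | succ n ih =>
    obtain ⟨R, rfl⟩ := derivative_surjective Q
    obtain ⟨P, hP, hPc⟩ := ih (fun k => ω k.castSucc) (fun k => c k.castSucc)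
      (R + C (c (Fin.last n) - R.eval (ω (Fin.last n))))
    refine ⟨P, by simp [Function.iterate_succ_apply', hP], fun k => ?_⟩
    induction k using Fin.lastCases with
    | last => simp [hP]
    | cast k => exact hPc k

theorem exists_polynomial_eLpNorm_sub_le {μ : Measure ℝ} [IsFiniteMeasure μ] {a b : ℝ}
    (hμ : ∀ᵐ x ∂μ, x ∈ Icc a b) {p : ENNReal} (hp : p ≠ ⊤) {g : ℝ → ℝ} (hg : MemLp g p μ)
    {ε : ENNReal} (hε : ε ≠ 0) :
    ∃ Q : ℝ[X], eLpNorm (g - fun x => Q.eval x) p μ ≤ ε := by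
  obtain ⟨δ, hδ, h_add⟩ := exists_Lp_half ℝ μ p hε
  obtain ⟨φ, hgφ, hφ⟩ := hg.exists_boundedContinuous_eLpNorm_sub_le hp hδ.ne'
  obtain ⟨η, hη, hηδ⟩ := ENNReal.exists_nnreal_pos_mul_lt
    (a := μ univ ^ p.toReal⁻¹) (by finiteness) hδ.ne'
  obtain ⟨Q, hQ⟩ :=
    exists_polynomial_near_of_continuousOn a b φ φ.continuous.continuousOn η hη
  have hφQ : eLpNorm (⇑φ - fun x => Q.eval x) p μ ≤ δ := by
    refine (eLpNorm_le_of_ae_bound (C := η) ?_).trans ?_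
    · filter_upwards [hμ] with x hx
      simpa [norm_sub_rev] using (hQ x hx).le
    · simpa [mul_comm] using hηδ.le
  refine ⟨Q, ?_⟩
  rw [← sub_add_sub_cancel g (⇑φ) fun x => Q.eval x]
  exact (h_add _ _ (hg.1.sub hφ.1)
    (φ.continuous.sub Q.continuous).aestronglyMeasurable hgφ hφQ).le

/-! ### The data isometry -/

theorem ae_jacobiMeasure_mem_Ioo (α β : ℝ) :
    ∀ᵐ x ∂jacobiMeasure α β, x ∈ Ioo (-1 : ℝ) 1 :=
  (jacobiMeasure_ac α β).ae_le (ae_restrict_mem measurableSet_Ioo)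

section Spaces

instance fact_one_le_ofReal {p : ℝ} [hp : Fact (1 ≤ p)] : Fact (1 ≤ ENNReal.ofReal p) :=
  ⟨ENNReal.one_le_ofReal.2 hp.out⟩

/-- The Banach space `ℝ^ℓ ⊕ L^p(μ^{α,β})`, an `ℓ^p` sum, in which the nodal values and the top
derivative of a function live. -/
abbrev DataSpace (p α β : ℝ) (ℓ : ℕ) : Type :=
  WithLp (ENNReal.ofReal p) (PiLp (ENNReal.ofReal p) (fun _ : Fin ℓ => ℝ) ×
    Lp ℝ (ENNReal.ofReal p) (jacobiMeasure α β))

variable (p α β : ℝ) (ℓ : ℕ) (ω : Fin ℓ → ℝ) [hp : Fact (1 ≤ p)]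

/-- The data of a suitable function: its nodal values `f^{(k)}(ω_k)` and the class of `f^{(ℓ)}`.
The norm of `SuitableFun` is exactly the one making this map an isometry. -/
def data : SuitableFun p α β ℓ ω →ₗᵢ[ℝ] DataSpace p α β ℓ where
  toFun f := WithLp.toLp _
    (WithLp.toLp _ fun k => iteratedDeriv k f.1 (ω k), f.2.memLp.toLp _)
  map_add' f g := by
    refine congrArg (WithLp.toLp _) (Prod.ext (congrArg (WithLp.toLp _) (funext fun k => ?_)) ?_)
    · exact ((f.2.diffAt_node k).add (g.2.diffAt_node k)).2
    · exact (MemLp.toLp_congr (f.2.add g.2).memLp (f.2.memLp.add g.2.memLp)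
        (f.2.ae_iteratedDeriv_add g.2)).trans (MemLp.toLp_add f.2.memLp g.2.memLp)
  map_smul' c f := by
    refine congrArg (WithLp.toLp _) (Prod.ext (congrArg (WithLp.toLp _) (funext fun k => ?_)) ?_)
    · exact congrFun (iteratedDeriv_smul' k c f.1) (ω k)
    · exact (MemLp.toLp_congr (f.2.smul c).memLp (f.2.memLp.const_smul c)
        (.of_eq (iteratedDeriv_smul' ℓ c f.1))).trans (MemLp.toLp_const_smul c f.2.memLp)
  norm_map' f := by
    have hp0 : 0 < p := one_pos.trans_le hp.out
    have hp_toReal : (ENNReal.ofReal p).toReal = p := ENNReal.toReal_ofReal hp0.le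
    change ‖WithLp.toLp (ENNReal.ofReal p) (WithLp.toLp (ENNReal.ofReal p)
      fun k : Fin ℓ => iteratedDeriv k f.1 (ω k), f.2.memLp.toLp _)‖ = jsNorm p α β ℓ ω f.1
    rw [jsNorm, f.2.integral_eq hp.out, WithLp.prod_norm_eq_add (hp_toReal.symm ▸ hp0),
      PiLp.norm_eq_sum (hp_toReal.symm ▸ hp0), hp_toReal, one_div,
      Real.rpow_inv_rpow (by positivity) hp0.ne', WithLp.toLp_snd, Lp.norm_toLp,
      toReal_eLpNorm f.2.memLp.1, abs_of_nonneg lpNorm_nonneg]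
    rfl

variable [hα : Fact (-1 < α)] [hβ : Fact (-1 < β)]

theorem exists_data_polyToFun_eq (c : Fin ℓ → ℝ)
    {g : Lp ℝ (ENNReal.ofReal p) (jacobiMeasure α β)} {Q : ℝ[X]}
    (hg : g =ᵐ[jacobiMeasure α β] fun x => Q.eval x) :
    ∃ P, data p α β ℓ ω (polyToFun p α β ℓ ω P) = WithLp.toLp _ (WithLp.toLp _ c, g) := by
  obtain ⟨P, hPQ, hPc⟩ := exists_iterate_derivative_eq_and_eval_eq ℓ ω c Q
  refine ⟨P, congrArg (WithLp.toLp _)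
    (Prod.ext (congrArg (WithLp.toLp _) (funext fun k => ?_)) (Lp.ext ?_))⟩
  · exact (congrFun (iteratedDeriv_eval k P) (ω k)).trans (hPc k)
  · refine (polyToFun p α β ℓ ω P).2.memLp.coeFn_toLp.trans (EventuallyEq.trans ?_ hg.symm)
    exact .of_eq ((iteratedDeriv_eval ℓ P).trans (by rw [hPQ]))

theorem denseRange_data_polyToFun :
    DenseRange fun P => data p α β ℓ ω (polyToFun p α β ℓ ω P) := by
  have := isFiniteMeasure_jacobiMeasure hα.out hβ.out
  rintro ⟨c, g⟩
  rw [Metric.mem_closure_range_iff]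
  intro ε hε
  obtain ⟨Q, hgQ⟩ := exists_polynomial_eLpNorm_sub_le
    ((ae_jacobiMeasure_mem_Ioo α β).mono fun _ hx => Ioo_subset_Icc_self hx)
    ENNReal.ofReal_ne_top (Lp.memLp g) (ε := ENNReal.ofReal (ε / 2)) (by simpa using hε)
  have hQ : MemLp (fun x => Q.eval x) (ENNReal.ofReal p) (jacobiMeasure α β) := by
    simpa using (isSuitable_eval hα.out hβ.out Fin.elim0 Q).memLp
  obtain ⟨P, hP⟩ := exists_data_polyToFun_eq p α β ℓ ω c.ofLp hQ.coeFn_toLp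
  refine ⟨P, ?_⟩
  rw [hP, dist_eq_norm, ← WithLp.toLp_sub, Prod.mk_sub_mk, ← WithLp.toLp_sub, sub_self,
    WithLp.toLp_zero, WithLp.norm_toLp_snd, Lp.norm_def]
  refine (ENNReal.toReal_le_of_le_ofReal (by positivity) ((eLpNorm_congr_ae ?_).trans_le
    hgQ)).trans_lt (half_lt_self hε)
  filter_upwards [Lp.coeFn_sub g (hQ.toLp _), hQ.coeFn_toLp] with x hx hQx
  rw [hx, Pi.sub_apply, Pi.sub_apply, hQx]

theorem denseRange_polyToFun : DenseRange (polyToFun p α β ℓ ω) := by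
  rw [DenseRange, (data p α β ℓ ω).isometry.isUniformInducing.isInducing.dense_iff]
  intro f
  rw [← range_comp]
  exact denseRange_data_polyToFun p α β ℓ ω _

theorem completeSpace_suitableFun_iff :
    CompleteSpace (SuitableFun p α β ℓ ω) ↔ Function.Surjective (data p α β ℓ ω) := by
  have h_inducing := (data p α β ℓ ω).isometry.isUniformInducing
  refine ⟨fun h => ?_, fun h => (h_inducing.completeSpace_congr h).2 inferInstance⟩
  have h_closed := ((completeSpace_iff_isComplete_range h_inducing).1 h).isClosed
  have h_dense : Dense (range (data p α β ℓ ω)) :=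
    (denseRange_data_polyToFun p α β ℓ ω).mono (range_comp_subset_range _ _)
  rw [← range_eq_univ, ← h_closed.closure_eq, h_dense.closure_eq]

/-- The class in `U` of a polynomial, as a linear map. -/
def polyToU : PolySpace p α β ℓ ω →ₗ[ℝ] U p α β ℓ ω where
  toFun P := SeparationQuotient.mk (polyToFun p α β ℓ ω P)
  map_add' P Q := by
    rw [← SeparationQuotient.mk_add]
    exact congrArg _ (Subtype.ext (funext fun x =>
      Polynomial.eval_add (x := x) (p := (show ℝ[X] from P)) (q := (show ℝ[X] from Q))))
  map_smul' c P := by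
    rw [RingHom.id_apply, ← SeparationQuotient.mk_smul]
    exact congrArg _ (Subtype.ext (funext fun x =>
      Polynomial.eval_smul (x := x) c (show ℝ[X] from P)))

theorem wEqU_iff_completeSpace :
    WEqU p α β ℓ ω ↔ CompleteSpace (SuitableFun p α β ℓ ω) := by
  constructor
  · rintro ⟨e, -⟩
    rw [← SeparationQuotient.completeSpace_iff]
    exact (e.isometry.isUniformInducing.completeSpace_congr e.surjective).2 inferInstance
  · intro h
    have h_dense : DenseRange (polyToU p α β ℓ ω) :=
      SeparationQuotient.surjective_mk.denseRange.comp (denseRange_polyToFun p α β ℓ ω)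
        SeparationQuotient.continuous_mk
    refine ⟨(LinearEquiv.refl ℝ (PolySpace p α β ℓ ω)).extendOfIsometry (polyToU p α β ℓ ω)
      (UniformSpace.Completion.toComplₗᵢ (𝕜 := ℝ)).toLinearMap h_dense
      UniformSpace.Completion.denseRange_coe UniformSpace.Completion.norm_coe, fun P => ?_⟩
    exact LinearEquiv.extendOfIsometry_eq _ (polyToU p α β ℓ ω) _ _ _ _ P

theorem wEqU_iff : WEqU p α β ℓ ω ↔
    ∀ g : ℝ → ℝ, MemLp g (ENNReal.ofReal p) (jacobiMeasure α β) →
      ∃ f, IsSuitable p α β ℓ ω f ∧ iteratedDeriv ℓ f =ᵐ[jacobiMeasure α β] g := by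
  rw [wEqU_iff_completeSpace, completeSpace_suitableFun_iff]
  refine ⟨fun h g hg => ?_, fun h => ?_⟩
  · obtain ⟨f, hf⟩ := h (WithLp.toLp _ (0, hg.toLp g))
    exact ⟨f.1, f.2, (MemLp.toLp_eq_toLp_iff f.2.memLp hg).1 (congrArg WithLp.snd hf)⟩
  · -- A polynomial of degree `< ℓ` corrects the nodal values without changing `f^{(ℓ)}`.
    rintro ⟨c, g⟩
    obtain ⟨f, hf, hfg⟩ := h g (Lp.memLp g)
    obtain ⟨P, hP⟩ := exists_data_polyToFun_eq p α β ℓ ω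
      (fun k => c k - iteratedDeriv k f (ω k)) (g := 0) (Q := 0)
      ((Lp.coeFn_zero ..).trans (.of_eq (by ext; simp)))
    let f₀ : SuitableFun p α β ℓ ω := ⟨f, hf⟩
    refine ⟨f₀ + polyToFun p α β ℓ ω P, ?_⟩
    rw [map_add, hP]
    refine congrArg (WithLp.toLp _)
      (Prod.ext (congrArg (WithLp.toLp _) (funext fun k => ?_)) (Lp.ext ?_))
    · exact add_sub_cancel (iteratedDeriv k f (ω k)) (c k)
    · refine (Lp.coeFn_add _ _).trans ?_
      filter_upwards [hf.memLp.coeFn_toLp, Lp.coeFn_zero ℝ (ENNReal.ofReal p)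
        (jacobiMeasure α β), hfg] with x hfx h0 hgx
      exact (congrArg₂ (· + ·) (hfx.trans hgx) h0).trans (add_zero _)

end Spaces

/-! ### The Jacobi weight -/

/-- The density `(1-x)^α (1+x)^β` of the Jacobi measure on `(-1,1)`. -/
def jacobiWeight (α β x : ℝ) : ℝ :=
  (1 - x) ^ α * (1 + x) ^ β

section Weight

variable {α β : ℝ} {g : ℝ → ℝ}

theorem jacobiWeight_pos {x : ℝ} (hx : x ∈ Ioo (-1 : ℝ) 1) : 0 < jacobiWeight α β x :=
  mul_pos (Real.rpow_pos_of_pos (sub_pos.2 hx.2) _)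
    (Real.rpow_pos_of_pos (neg_lt_iff_pos_add'.1 hx.1) _)

theorem jacobiWeight_rpow {x : ℝ} (hx : x ∈ Ioo (-1 : ℝ) 1) (s : ℝ) :
    jacobiWeight α β x ^ s = jacobiWeight (α * s) (β * s) x := by
  have h1 : 0 ≤ 1 - x := by linarith [hx.2]
  have h2 : 0 ≤ 1 + x := by linarith [hx.1]
  rw [jacobiWeight, jacobiWeight, Real.mul_rpow (by positivity) (by positivity),
    Real.rpow_mul h1, Real.rpow_mul h2]

theorem measurable_jacobiWeight : Measurable (jacobiWeight α β) := by
  unfold jacobiWeight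
  fun_prop

theorem continuousOn_jacobiWeight : ContinuousOn (jacobiWeight α β) (Ioo (-1) 1) :=
  (ContinuousOn.rpow_const (by fun_prop) fun _ hx => .inl (sub_pos.2 hx.2).ne').mul
    (ContinuousOn.rpow_const (by fun_prop) fun _ hx => .inl (neg_lt_iff_pos_add'.1 hx.1).ne')

theorem restrict_ac_jacobiMeasure (α β : ℝ) :
    volume.restrict (Ioo (-1 : ℝ) 1) ≪ jacobiMeasure α β := by
  refine withDensity_absolutelyContinuous' (by fun_prop) ?_
  filter_upwards [ae_restrict_mem measurableSet_Ioo] with x hx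
  exact (ENNReal.ofReal_pos.2 (jacobiWeight_pos hx)).ne'

theorem integrable_jacobiMeasure_iff :
    Integrable g (jacobiMeasure α β) ↔
      IntegrableOn (fun x => jacobiWeight α β x * g x) (Ioo (-1) 1) := by
  rw [jacobiMeasure, IntegrableOn, integrable_withDensity_iff_integrable_smul' (by fun_prop)
    (.of_forall fun _ => ENNReal.ofReal_lt_top)]
  refine integrable_congr ?_
  filter_upwards [ae_restrict_mem measurableSet_Ioo] with x hx
  rw [← jacobiWeight, ENNReal.toReal_ofReal (jacobiWeight_pos hx).le, smul_eq_mul]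

theorem memLp_jacobiMeasure_iff {p : ℝ} (hp : 0 < p)
    (hg : AEStronglyMeasurable g (volume.restrict (Ioo (-1) 1))) :
    MemLp g (ENNReal.ofReal p) (jacobiMeasure α β) ↔
      IntegrableOn (fun x => jacobiWeight α β x * |g x| ^ p) (Ioo (-1) 1) := by
  rw [← integrable_norm_rpow_iff (hg.mono_ac (jacobiMeasure_ac α β)) (by simpa using hp)
    ENNReal.ofReal_ne_top, ENNReal.toReal_ofReal hp.le, integrable_jacobiMeasure_iff]
  rfl

theorem integrableOn_jacobiWeight (hα : -1 < α) (hβ : -1 < β) :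
    IntegrableOn (jacobiWeight α β) (Ioo (-1) 1) := by
  have := isFiniteMeasure_jacobiMeasure hα hβ
  simpa using integrable_jacobiMeasure_iff.1 (integrable_const (μ := jacobiMeasure α β) (1 : ℝ))

theorem integrableOn_of_integrable_mul_inv_jacobiWeight
    (hg : Integrable (g * (jacobiWeight α β)⁻¹) (jacobiMeasure α β)) :
    IntegrableOn g (Ioo (-1) 1) := by
  refine (integrable_jacobiMeasure_iff.1 hg).congr_fun (fun x hx => ?_) measurableSet_Ioo
  exact mul_div_cancel₀ (g x) (jacobiWeight_pos hx).ne'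

theorem locallyIntegrableOn_of_integrable (hg : Integrable g (jacobiMeasure α β)) :
    LocallyIntegrableOn g (Ioo (-1) 1) := by
  refine LocallyIntegrableOn.congr ?_ ((integrable_jacobiMeasure_iff.1 hg).locallyIntegrableOn
    |>.continuousOn_mul (continuousOn_jacobiWeight (α := α) (β := β) |>.inv₀
      fun _ hx => (jacobiWeight_pos hx).ne') isOpen_Ioo.isLocallyClosed)
  filter_upwards [ae_restrict_mem measurableSet_Ioo] with x hx
  exact inv_mul_cancel_left₀ (jacobiWeight_pos hx).ne' (g x)

end Weight

/-! ### When every function of `L^p(μ^{α,β})` is integrable -/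

/-- The inclusion `L^p(μ^{α,β}) ⊆ L^1(-1,1)`, the second space being taken with respect to Lebesgue
measure. -/
def LpSubsetL1 (p : ENNReal) (α β : ℝ) : Prop :=
  ∀ g : ℝ → ℝ, MemLp g p (jacobiMeasure α β) → IntegrableOn g (Ioo (-1) 1)

section Inclusion

variable {p α β : ℝ}

theorem lpSubsetL1_of_memLp_inv_jacobiWeight {p q : ENNReal} [p.HolderConjugate q]
    (hw : MemLp (jacobiWeight α β)⁻¹ q (jacobiMeasure α β)) :
    LpSubsetL1 p α β := fun _ hg =>
  integrableOn_of_integrable_mul_inv_jacobiWeight (hg.integrable_mul hw)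

theorem memLp_inv_jacobiWeight {q : ℝ} (hq : 0 < q) (hα : -1 < α * (1 - q))
    (hβ : -1 < β * (1 - q)) :
    MemLp (jacobiWeight α β)⁻¹ (ENNReal.ofReal q) (jacobiMeasure α β) := by
  rw [memLp_jacobiMeasure_iff hq measurable_jacobiWeight.inv.aestronglyMeasurable]
  refine (integrableOn_jacobiWeight hα hβ).congr_fun (fun x hx => ?_) measurableSet_Ioo
  have hw : 0 < jacobiWeight α β x := jacobiWeight_pos hx
  rw [← jacobiWeight_rpow hx, Pi.inv_apply, abs_of_pos (inv_pos.2 hw), Real.inv_rpow hw.le,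
    Real.rpow_sub hw, Real.rpow_one, div_eq_mul_inv]

theorem lpSubsetL1_of_lt_sub_one (hp : 1 < p) (hα : α < p - 1) (hβ : β < p - 1) :
    LpSubsetL1 (ENNReal.ofReal p) α β := by
  have hpq := Real.HolderConjugate.conjExponent hp
  have := hpq.ennrealOfReal
  have hq : 1 - p.conjExponent = -(p - 1)⁻¹ := by
    have := sub_pos.2 hp
    rw [Real.conjExponent]
    field_simp
    ring
  have h_exp {γ : ℝ} (hγ : γ < p - 1) : -1 < γ * (1 - p.conjExponent) := by
    rw [hq, mul_neg, neg_lt_neg_iff, ← div_eq_mul_inv, div_lt_one (sub_pos.2 hp)]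
    exact hγ
  exact lpSubsetL1_of_memLp_inv_jacobiWeight
    (memLp_inv_jacobiWeight hpq.symm.pos (h_exp hα) (h_exp hβ))

theorem lpSubsetL1_one_of_nonpos (hα : α ≤ 0) (hβ : β ≤ 0) : LpSubsetL1 1 α β := by
  refine lpSubsetL1_of_memLp_inv_jacobiWeight (q := ⊤) (memLp_top_of_bound
    measurable_jacobiWeight.inv.aestronglyMeasurable (2 ^ α * 2 ^ β : ℝ)⁻¹ ?_)
  filter_upwards [ae_jacobiMeasure_mem_Ioo α β] with x hx
  have h1 : 0 < 1 - x := by linarith [hx.2]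
  have h2 : 0 < 1 + x := by linarith [hx.1]
  rw [Pi.inv_apply, norm_inv, Real.norm_of_nonneg (jacobiWeight_pos hx).le]
  refine inv_anti₀ (by positivity) (mul_le_mul ?_ ?_ (by positivity) (by positivity))
  · exact Real.rpow_le_rpow_of_nonpos h1 (by linarith [hx.1]) hα
  · exact Real.rpow_le_rpow_of_nonpos h2 (by linarith [hx.2]) hβ

end Inclusion

/-! ### Solving `f^{(ℓ)} = g` -/

section Primitives

variable {E : Type*} [NormedAddCommGroup E] [NormedSpace ℝ E] [CompleteSpace E]

theorem exists_contDiff_iteratedDeriv_eq (n : ℕ) {φ : ℝ → E} (hφ : Continuous φ) :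
    ∃ F : ℝ → E, ContDiff ℝ n F ∧ iteratedDeriv n F = φ := by
  induction n with
  | zero => exact ⟨φ, contDiff_zero.2 hφ, iteratedDeriv_zero⟩
  | succ n ih =>
    obtain ⟨F, hF, hFn⟩ := ih
    have h_deriv : ∀ x, HasDerivAt (fun x => ∫ t in (0 : ℝ)..x, F t) (F x) x :=
      fun x => (hF.continuous.integral_hasStrictDerivAt 0 x).hasDerivAt
    have h_deriv_eq : deriv (fun x => ∫ t in (0 : ℝ)..x, F t) = F :=
      funext fun x => (h_deriv x).deriv
    refine ⟨fun x => ∫ t in (0 : ℝ)..x, F t, ?_, ?_⟩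
    · rw [Nat.cast_add_one, contDiff_succ_iff_deriv, h_deriv_eq]
      exact ⟨fun x => (h_deriv x).differentiableAt, by simp, hF⟩
    · rw [iteratedDeriv_succ', h_deriv_eq, hFn]

theorem ae_hasDerivAt_integral_of_locallyIntegrableOn {g : ℝ → E} {a b c : ℝ}
    (hg : LocallyIntegrableOn g (Ioo a b)) (hc : c ∈ Ioo a b) :
    ∀ᵐ x, x ∈ Ioo a b → HasDerivAt (fun x => ∫ t in c..x, g t) (g x) x := by
  refine measure_null_of_locally_null _ fun x hx => ?_
  have hx : x ∈ Ioo a b := (Classical.not_imp.1 hx).1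
  obtain ⟨a', ha, ha'⟩ := exists_between (lt_min hx.1 hc.1)
  obtain ⟨b', hb', hb⟩ := exists_between (max_lt hx.2 hc.2)
  have hx' : x ∈ Ioo a' b' := ⟨ha'.trans_le (min_le_left _ _), (le_max_left _ _).trans_lt hb'⟩
  have hc' : c ∈ Ioo a' b' := ⟨ha'.trans_le (min_le_right _ _), (le_max_right _ _).trans_lt hb'⟩
  have h_sub : uIcc a' b' ⊆ Ioo a b := by
    rw [uIcc_of_le (hx'.1.trans hx'.2).le]
    exact Icc_subset_Ioo ha hb
  have h_int : IntervalIntegrable g volume a' b' :=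
    (hg.integrableOn_compact_subset h_sub isCompact_uIcc).intervalIntegrable
  refine ⟨_, inter_mem_nhdsWithin _ (isOpen_Ioo.mem_nhds hx'), ?_⟩
  refine measure_mono_null ?_ h_int.ae_hasDerivAt_integral
  rintro y ⟨hy, hy'⟩ h
  exact hy fun _ => h (Icc_subset_uIcc (Ioo_subset_Icc_self hy')) c
    (Icc_subset_uIcc (Ioo_subset_Icc_self hc'))

end Primitives

theorem DiffAtOrder.of_contDiff {k : ℕ} {f : ℝ → ℝ} (hf : ContDiff ℝ k f) (x : ℝ) :
    DiffAtOrder k f x := by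
  induction k generalizing x with
  | zero => trivial
  | succ k ih =>
    exact ⟨.of_forall (ih (hf.of_le (by exact_mod_cast k.le_succ))),
      hf.differentiable_iteratedDeriv k (by exact_mod_cast k.lt_succ_self) x⟩

section Solvability

variable {p α β : ℝ} {n : ℕ} {f g F : ℝ → ℝ}

theorem iteratedDeriv_succ_ae_eq_of_eq_integral (hg : LocallyIntegrableOn g (Ioo (-1) 1))
    (hF : iteratedDeriv n F = fun x => ∫ t in (0 : ℝ)..x, g t) :
    iteratedDeriv (n + 1) F =ᵐ[jacobiMeasure α β] g := by
  refine (jacobiMeasure_ac α β).ae_eq ((ae_restrict_iff' measurableSet_Ioo).2 ?_)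
  filter_upwards [ae_hasDerivAt_integral_of_locallyIntegrableOn hg (c := 0) (by norm_num)]
    with x h_deriv hx
  rw [iteratedDeriv_succ, hF, (h_deriv hx).deriv]

theorem isSuitable_of_iteratedDeriv_eq_integral (ω : Fin (n + 1) → ℝ)
    (hF : ∀ k ≤ n, ∀ x, DiffAtOrder k F x) (hg : LocallyIntegrableOn g (Ioo (-1) 1))
    (hF_eq : iteratedDeriv n F = fun x => ∫ t in (0 : ℝ)..x, g t)
    (hgp : MemLp g (ENNReal.ofReal p) (jacobiMeasure α β)) :
    IsSuitable p α β (n + 1) ω F where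
  diffAt_node k := hF k (Nat.le_of_lt_succ k.2) _
  diffAt_interior x _ := hF n le_rfl x
  absCont a b ha hab hb := by
    have h_sub : uIcc (min a 0) (max b 0) ⊆ Ioo (-1) 1 := by
      rw [uIcc_of_le ((min_le_right _ _).trans (le_max_right _ _))]
      exact Icc_subset_Ioo (lt_min ha (by norm_num)) (max_lt hb (by norm_num))
    have h_int : IntervalIntegrable g volume (min a 0) (max b 0) :=
      (hg.integrableOn_compact_subset h_sub isCompact_uIcc).intervalIntegrable
    rw [Nat.add_sub_cancel, hF_eq]
    refine (h_int.absolutelyContinuousOnInterval_intervalIntegral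
      (Icc_subset_uIcc ⟨min_le_right _ _, le_max_right _ _⟩)).mono ?_
    rw [uIcc_of_le hab]
    exact (Icc_subset_Icc (min_le_left _ _) (le_max_left _ _)).trans Icc_subset_uIcc
  memLp := hgp.ae_eq (iteratedDeriv_succ_ae_eq_of_eq_integral hg hF_eq).symm

variable [hp : Fact (1 ≤ p)] [hα : Fact (-1 < α)] [hβ : Fact (-1 < β)]

theorem locallyIntegrableOn_of_memLp (hg : MemLp g (ENNReal.ofReal p) (jacobiMeasure α β)) :
    LocallyIntegrableOn g (Ioo (-1) 1) :=
  have := isFiniteMeasure_jacobiMeasure hα.out hβ.out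
  locallyIntegrableOn_of_integrable (hg.integrable (ENNReal.one_le_ofReal.2 hp.out))

variable (p α β) in
theorem wEqU_one (ω : Fin 1 → ℝ) : WEqU p α β 1 ω := by
  refine (wEqU_iff p α β 1 ω).2 fun g hg => ⟨fun x => ∫ t in (0 : ℝ)..x, g t, ?_, ?_⟩
  · refine isSuitable_of_iteratedDeriv_eq_integral ω (fun k hk x => ?_)
      (locallyIntegrableOn_of_memLp hg) iteratedDeriv_zero hg
    rw [Nat.le_zero.1 hk]
    trivial
  · exact iteratedDeriv_succ_ae_eq_of_eq_integral (locallyIntegrableOn_of_memLp hg)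
      iteratedDeriv_zero

theorem wEqU_of_lpSubsetL1 (h : LpSubsetL1 (ENNReal.ofReal p) α β) (ω : Fin (n + 1) → ℝ) :
    WEqU p α β (n + 1) ω := by
  refine (wEqU_iff p α β (n + 1) ω).2 fun g hg => ?_
  have h_ae : (Ioo (-1) 1).indicator g =ᵐ[jacobiMeasure α β] g :=
    (ae_jacobiMeasure_mem_Ioo α β).mono fun _ hx => indicator_of_mem hx g
  have hG : MemLp ((Ioo (-1) 1).indicator g) (ENNReal.ofReal p) (jacobiMeasure α β) :=
    hg.ae_eq h_ae.symm
  have hG_loc := locallyIntegrableOn_of_memLp hG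
  obtain ⟨F, hF, hFn⟩ := exists_contDiff_iteratedDeriv_eq n (intervalIntegral.continuous_primitive
    (fun _ _ => ((integrable_indicator_iff measurableSet_Ioo).2 (h g hg)).intervalIntegrable) 0)
  refine ⟨F, isSuitable_of_iteratedDeriv_eq_integral ω (fun k hk x => ?_) hG_loc hFn hG,
    (iteratedDeriv_succ_ae_eq_of_eq_integral hG_loc hFn).trans h_ae⟩
  exact .of_contDiff (hF.of_le (by exact_mod_cast hk)) x

end Solvability

/-! ### Differentiability at an endpoint forces integrability -/

section Convexity

variable {f : ℝ → ℝ} {a b : ℝ} {s : Set ℝ}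

theorem monotoneOn_of_absolutelyContinuousOnInterval (hf : AbsolutelyContinuousOnInterval f a b)
    (h_nonneg : ∀ᵐ x, x ∈ uIcc a b → 0 ≤ deriv f x) : MonotoneOn f (uIcc a b) := by
  intro x hx y hy hxy
  have h_sub : uIcc x y ⊆ uIcc a b := uIcc_subset_uIcc hx hy
  rw [← sub_nonneg, ← (hf.mono h_sub).integral_deriv_eq_sub]
  refine intervalIntegral.integral_nonneg_of_ae_restrict hxy ?_
  rw [EventuallyLE, ae_restrict_iff' measurableSet_Icc]
  exact h_nonneg.mono fun z hz hz' => hz (h_sub (Icc_subset_uIcc hz'))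

theorem monotoneOn_deriv_of_monotoneOn_interior (hs : Convex ℝ s)
    (hf : ∀ x ∈ s, DifferentiableAt ℝ f x) (h_mono : MonotoneOn (deriv f) (interior s)) :
    MonotoneOn (deriv f) s :=
  (h_mono.convexOn_of_deriv hs (fun x hx => (hf x hx).continuousAt.continuousWithinAt)
    fun x hx => (hf x (interior_subset hx)).differentiableWithinAt).monotoneOn_deriv hf

end Convexity

section Necessity

variable {p α β : ℝ} {n : ℕ} {f : ℝ → ℝ}

namespace IsSuitable

theorem monotoneOn_iteratedDeriv_of_nonneg {ω : Fin (n + 1) → ℝ}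
    (hf : IsSuitable p α β (n + 1) ω f)
    (h_nonneg : 0 ≤ᵐ[jacobiMeasure α β] iteratedDeriv (n + 1) f) :
    MonotoneOn (iteratedDeriv n f) (Ioo (-1) 1) := by
  intro x hx y hy hxy
  refine monotoneOn_of_absolutelyContinuousOnInterval (hf.absCont x y hx.1 hxy hy.2) ?_
    left_mem_uIcc right_mem_uIcc hxy
  have h_ae := (ae_restrict_iff' measurableSet_Ioo).1
    ((restrict_ac_jacobiMeasure α β).ae_le h_nonneg)
  filter_upwards [h_ae] with z hz hz'
  have := hz (ordConnected_Ioo.uIcc_subset hx hy hz')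
  rwa [iteratedDeriv_succ] at this

theorem intervalIntegrable_of_nonneg {ω : Fin (n + 2) → ℝ}
    (hf : IsSuitable p α β (n + 2) ω f)
    (h_nonneg : 0 ≤ᵐ[jacobiMeasure α β] iteratedDeriv (n + 2) f)
    (hω : ω (Fin.last (n + 1)) ∈ Icc (-1) 1) :
    IntervalIntegrable (iteratedDeriv (n + 2) f) volume 0 (ω (Fin.last (n + 1))) := by
  set c := ω (Fin.last (n + 1))
  have h_diff : ∀ x ∈ uIcc 0 c, DifferentiableAt ℝ (iteratedDeriv n f) x := by
    intro x hx
    rcases eq_or_ne x c with rfl | hxc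
    · exact (hf.diffAt_node (Fin.last (n + 1))).2
    · have hx' : x ∈ Ioo (-1) 1 := by
        rcases mem_uIcc.1 hx with h | h <;> grind
      exact (hf.diffAt_interior x hx').2
  have h_mono : MonotoneOn (iteratedDeriv (n + 1) f) (uIcc 0 c) := by
    rw [iteratedDeriv_succ]
    refine monotoneOn_deriv_of_monotoneOn_interior (convex_uIcc 0 c) h_diff ?_
    rw [← iteratedDeriv_succ, uIcc, interior_Icc]
    exact (hf.monotoneOn_iteratedDeriv_of_nonneg h_nonneg).mono
      (Ioo_subset_Ioo (le_min (by norm_num) hω.1) (max_le (by norm_num) hω.2))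
  rw [iteratedDeriv_succ]
  exact h_mono.intervalIntegrable_deriv

end IsSuitable

variable [hp : Fact (1 ≤ p)] [hα : Fact (-1 < α)] [hβ : Fact (-1 < β)]

theorem lpSubsetL1_of_forall_wEqU (h : ∀ ω : Fin (n + 2) → ℝ, WEqU p α β (n + 2) ω) :
    LpSubsetL1 (ENNReal.ofReal p) α β := by
  intro g hg
  have h_int {c : ℝ} (hc : c ∈ Icc (-1) 1) : IntervalIntegrable g volume 0 c := by
    obtain ⟨f, hf, hfg⟩ := (wEqU_iff p α β (n + 2) _).1 (h fun _ => c) |g| hg.abs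
    have h_ac : volume.restrict (uIoc 0 c) ≪ jacobiMeasure α β := by
      refine Measure.AbsolutelyContinuous.trans ?_ (restrict_ac_jacobiMeasure α β)
      rw [Measure.restrict_congr_set Ioo_ae_eq_Ioc]
      exact (Measure.restrict_mono_set _ (Ioc_subset_Ioc (le_min (by norm_num) hc.1)
        (max_le (by norm_num) hc.2))).absolutelyContinuous
    exact (hf.intervalIntegrable_of_nonneg (hfg.mono fun x hx => hx ▸ abs_nonneg (g x)) hc).mono_fun
      (hg.1.mono_ac h_ac) (h_ac.ae_le (hfg.mono fun x hx => by simp [hx]))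
  have h_union := ((h_int (c := -1) (by norm_num)).symm.trans (h_int (c := 1) (by norm_num)))
  exact ((intervalIntegrable_iff_integrableOn_Ioo_of_le (by norm_num)).1 h_union)

theorem forall_wEqU_iff :
    (∀ ω : Fin (n + 2) → ℝ, WEqU p α β (n + 2) ω) ↔ LpSubsetL1 (ENNReal.ofReal p) α β :=
  ⟨lpSubsetL1_of_forall_wEqU, wEqU_of_lpSubsetL1⟩

end Necessity

/-! ### Functions of `L^p(μ^{α,β})` that are not integrable -/

section Reflection

variable {p : ENNReal} {α β : ℝ}

theorem measurePreserving_neg_jacobiMeasure (α β : ℝ) :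
    MeasurePreserving Neg.neg (jacobiMeasure α β) (jacobiMeasure β α) := by
  have h_restrict : MeasurePreserving Neg.neg (volume.restrict (Ioo (-1 : ℝ) 1))
      (volume.restrict (Ioo (-1) 1)) := by
    simpa using (Measure.measurePreserving_neg (volume : Measure ℝ)).restrict_preimage
      (measurableSet_Ioo (a := (-1 : ℝ)) (b := 1))
  refine ⟨measurable_neg, Measure.ext fun s hs => ?_⟩
  rw [Measure.map_apply measurable_neg hs, jacobiMeasure, jacobiMeasure,
    withDensity_apply _ (measurable_neg hs), withDensity_apply _ hs,
    ← h_restrict.setLIntegral_comp_preimage hs (by fun_prop)]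
  simp only [sub_neg_eq_add, ← sub_eq_add_neg, mul_comm]

theorem LpSubsetL1.swap (h : LpSubsetL1 p α β) : LpSubsetL1 p β α := by
  intro g hg
  have h_neg := h _ (hg.comp_measurePreserving (measurePreserving_neg_jacobiMeasure α β))
  have := ((Measure.measurePreserving_neg (volume : Measure ℝ)).integrableOn_comp_preimage
    (MeasurableEquiv.neg ℝ).measurableEmbedding (s := Ioo (-1) 1) (f := g)).1
  simp only [neg_preimage, neg_Ioo, neg_neg] at this
  exact this h_neg

end Reflection

section LogPower

/-- The family `(1-x)⁻¹ (1 - log (1-x))^s`, whose integrability at `1` is decided by the logarithmic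
factor. -/
def logPower (s x : ℝ) : ℝ :=
  (1 - x)⁻¹ * (1 - Real.log (1 - x)) ^ s

theorem measurable_logPower (s : ℝ) : Measurable (logPower s) := by
  unfold logPower
  fun_prop

theorem image_one_sub_log : (fun x : ℝ => 1 - Real.log (1 - x)) '' Ioo 0 1 = Ioi 1 := by
  ext u
  constructor
  · rintro ⟨x, hx, rfl⟩
    have := Real.log_neg (sub_pos.2 hx.2) (sub_lt_self 1 hx.1)
    exact mem_Ioi.2 (by linarith)
  · intro hu
    refine ⟨1 - Real.exp (1 - u), ⟨?_, ?_⟩, by simp⟩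
    · exact sub_pos.2 (Real.exp_lt_one_iff.2 (sub_neg.2 hu))
    · exact sub_lt_self 1 (Real.exp_pos _)

theorem one_sub_log_pos {x : ℝ} (hx : x ∈ Ioo (0 : ℝ) 1) : 0 < 1 - Real.log (1 - x) :=
  one_pos.trans (image_one_sub_log.subset (mem_image_of_mem _ hx))

theorem abs_logPower_rpow {x : ℝ} (hx : x ∈ Ioo (0 : ℝ) 1) (s p : ℝ) :
    |logPower s x| ^ p = (1 - x) ^ (-p) * (1 - Real.log (1 - x)) ^ (s * p) := by
  have h1 : 0 < 1 - x := sub_pos.2 hx.2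
  have h2 : 0 < 1 - Real.log (1 - x) := one_sub_log_pos hx
  rw [logPower, abs_of_pos (by positivity), Real.mul_rpow (by positivity) (by positivity),
    Real.inv_rpow h1.le, ← Real.rpow_neg h1.le, ← Real.rpow_mul h2.le]

theorem integrableOn_logPower_iff {s : ℝ} : IntegrableOn (logPower s) (Ioo 0 1) ↔ s < -1 := by
  have h_deriv : ∀ x ∈ Ioo (0 : ℝ) 1,
      HasDerivWithinAt (fun x : ℝ => 1 - Real.log (1 - x)) (1 - x)⁻¹ (Ioo 0 1) x := by
    intro x hx
    have := (((hasDerivAt_id x).const_sub 1).log (sub_pos.2 hx.2).ne').const_sub 1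
    simpa [neg_div] using this.hasDerivWithinAt
  have h_mono : MonotoneOn (fun x : ℝ => 1 - Real.log (1 - x)) (Ioo 0 1) := fun x _ y hy hxy =>
    sub_le_sub_left (Real.log_le_log (sub_pos.2 hy.2) (sub_le_sub_left hxy 1)) 1
  rw [← integrableOn_Ioi_rpow_iff one_pos, ← image_one_sub_log,
    integrableOn_image_iff_integrableOn_deriv_smul_of_monotoneOn measurableSet_Ioo h_deriv h_mono]
  rfl

end LogPower

namespace LpSubsetL1

variable {p α β : ℝ}

theorem integrableOn_Ioo_zero_one (h : LpSubsetL1 (ENNReal.ofReal p) α β) (hp : 0 < p) {v : ℝ → ℝ}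
    (hv : Measurable v) (h_int : IntegrableOn (fun x => (1 - x) ^ α * |v x| ^ p) (Ioo 0 1)) :
    IntegrableOn v (Ioo 0 1) := by
  have h_sub : Ioo (0 : ℝ) 1 ⊆ Ioo (-1) 1 := Ioo_subset_Ioo_left (by norm_num)
  have h_memLp : MemLp ((Ioo 0 1).indicator v) (ENNReal.ofReal p) (jacobiMeasure α β) := by
    rw [memLp_jacobiMeasure_iff hp (hv.indicator measurableSet_Ioo).aestronglyMeasurable]
    have h_cont : ContinuousOn (fun x : ℝ => (1 + x) ^ β) (Icc 0 1) :=
      ContinuousOn.rpow_const (by fun_prop) fun x hx => .inl (by linarith [hx.1])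
    have := (integrable_indicator_iff measurableSet_Ioo).2
      (h_int.continuousOn_mul_of_subset h_cont isCompact_Icc measurableSet_Ioo Ioo_subset_Icc_self)
    refine this.integrableOn.congr_fun (fun x _ => ?_) measurableSet_Ioo
    by_cases hx : x ∈ Ioo (0 : ℝ) 1
    · simp only [indicator_of_mem hx, jacobiWeight]
      ring
    · simp [indicator_of_notMem hx, hp.ne']
  exact ((h _ h_memLp).mono_set h_sub).congr_fun (fun x hx => indicator_of_mem hx v)
    measurableSet_Ioo

theorem lt_sub_one (h : LpSubsetL1 (ENNReal.ofReal p) α β) (hp : 1 < p) : α < p - 1 := by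
  by_contra! hα
  refine lt_irrefl (-1 : ℝ) (integrableOn_logPower_iff.1 (h.integrableOn_Ioo_zero_one
    (one_pos.trans hp) (measurable_logPower _) ?_))
  have h_dom : IntegrableOn (logPower (-p)) (Ioo 0 1) := integrableOn_logPower_iff.2 (by linarith)
  refine h_dom.mono' (by unfold logPower; fun_prop) ?_
  filter_upwards [ae_restrict_mem measurableSet_Ioo] with x hx
  have h1 : 0 < 1 - x := sub_pos.2 hx.2
  rw [Real.norm_of_nonneg (by positivity)]
  calc (1 - x) ^ α * |logPower (-1) x| ^ p
      = (1 - x) ^ (α - p) * (1 - Real.log (1 - x)) ^ (-p) := by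
        rw [abs_logPower_rpow hx, ← mul_assoc, ← Real.rpow_add h1, neg_one_mul, ← sub_eq_add_neg]
    _ ≤ (1 - x)⁻¹ * (1 - Real.log (1 - x)) ^ (-p) := by
        rw [← Real.rpow_neg_one]
        exact mul_le_mul_of_nonneg_right
          (Real.rpow_le_rpow_of_exponent_ge h1 (by linarith [hx.1]) (by linarith))
          (Real.rpow_nonneg (one_sub_log_pos hx).le _)

theorem nonpos (h : LpSubsetL1 1 α β) : α ≤ 0 := by
  by_contra! hα
  rw [← ENNReal.ofReal_one] at h
  refine absurd (integrableOn_logPower_iff.1 (h.integrableOn_Ioo_zero_one one_pos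
    (measurable_logPower 0) ?_)) (by norm_num)
  refine ((integrableOn_jacobiWeight (α := α - 1) (β := 0) (by linarith) (by norm_num)).mono_set
    (Ioo_subset_Ioo_left (by norm_num))).congr_fun (fun x hx => ?_) measurableSet_Ioo
  have h1 : 0 < 1 - x := sub_pos.2 hx.2
  simp only [jacobiWeight, logPower, Real.rpow_zero, Real.rpow_one, mul_one,
    abs_of_pos (inv_pos.2 h1), Real.rpow_sub_one h1.ne', div_eq_mul_inv]

end LpSubsetL1

theorem lpSubsetL1_iff_of_one_lt {p α β : ℝ} (hp : 1 < p) :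
    LpSubsetL1 (ENNReal.ofReal p) α β ↔ α < p - 1 ∧ β < p - 1 :=
  ⟨fun h => ⟨h.lt_sub_one hp, h.swap.lt_sub_one hp⟩, fun h => lpSubsetL1_of_lt_sub_one hp h.1 h.2⟩

theorem lpSubsetL1_one_iff {α β : ℝ} : LpSubsetL1 1 α β ↔ α ≤ 0 ∧ β ≤ 0 :=
  ⟨fun h => ⟨h.nonpos, h.swap.nonpos⟩, fun h => lpSubsetL1_one_of_nonpos h.1 h.2⟩

end

end JacobiSobolev

theorem mainTheorem3 (p α β : ℝ) [Fact (1 ≤ p)] [Fact (-1 < α)] [Fact (-1 < β)] :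
    (∀ ω : Fin 1 → ℝ, JacobiSobolev.WEqU p α β 1 ω) ∧
    (∀ ℓ : ℕ, 2 ≤ ℓ → 1 < p →
      ((∀ ω : Fin ℓ → ℝ, JacobiSobolev.WEqU p α β ℓ ω) ↔
        α ∈ Set.Ioo (-1) (p - 1) ∧ β ∈ Set.Ioo (-1) (p - 1))) ∧
    (∀ ℓ : ℕ, 2 ≤ ℓ → p = 1 →
      ((∀ ω : Fin ℓ → ℝ, JacobiSobolev.WEqU p α β ℓ ω) ↔
        α ∈ Set.Ioc (-1) 0 ∧ β ∈ Set.Ioc (-1) 0)) := by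
  have hα : -1 < α := Fact.out
  have hβ : -1 < β := Fact.out
  refine ⟨JacobiSobolev.wEqU_one p α β, fun ℓ hℓ hp => ?_, fun ℓ hℓ hp => ?_⟩
  · obtain ⟨n, rfl⟩ := Nat.exists_eq_add_of_le' hℓ
    rw [JacobiSobolev.forall_wEqU_iff, JacobiSobolev.lpSubsetL1_iff_of_one_lt hp]
    simp only [Set.mem_Ioo, hα, hβ, true_and]
  · obtain ⟨n, rfl⟩ := Nat.exists_eq_add_of_le' hℓ
    rw [JacobiSobolev.forall_wEqU_iff, hp, ENNReal.ofReal_one, JacobiSobolev.lpSubsetL1_one_iff]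
    simp only [Set.mem_Ioc, hα, hβ, true_and]
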